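/- For complex $a_1,\dots,a_p$ and complex $b_1,\dots,b_q$, none of the $b_j$ a non-positive integer, with $p\le q$, let $${}_pF_q(a_1,\dots,a_p;b_1,\dots,b_q;z)=\sum_{n=0}^{\infty}\frac{(a_1)_n\cdots(a_p)_n}{(b_1)_n\cdots(b_q)_n}\,\frac{z^n}{n!},\qquad (x)_n=x(x+1)\cdots(x+n-1),$$ and let ${}_p\tilde F_q(a_1,\dots,a_p;b_1,\dots,b_q;z)={}_pF_q(a_1,\dots,a_p;b_1,\dots,b_q;z)/\bigl(\Gamma(b_1)\cdots\Gamma(b_q)\bigr)$ be the regularized function. Then for every $z\in\mathbb{C}$ (with $z^0=1$) $$\begin{aligned}{}_2F_3\left(\tfrac12,\tfrac12;1,1,\tfrac32;z\right)&=\sum_{L=0}^{\infty}\frac{\pi^{2}\,i^{4L}\,2^{-8L-6}\left((-1)^{L}+1\right)^{2}(2L+1)\,\Gamma(2L+2)^{2}}{\Gamma\left(\frac L2+1\right)^{4}\,\Gamma\left(L+\frac32\right)^{2}\,\Gamma\left(\frac12(2L+3)\right)^{2}}\,z^{L}\;{}_1F_2\left(\tfrac L2+\tfrac12;\tfrac L2+1,L+\tfrac32;\tfrac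 z4\right)^{2}\\&=\sum_{L=0}^{\infty}\frac{\pi^{2}\,i^{4L}\,2^{-8L-6}\left((-1)^{L}+1\right)^{2}(2L+1)\,\Gamma(2L+2)^{2}}{\Gamma\left(\frac L2+1\right)^{2}\,\Gamma\left(\frac12(2L+3)\right)^{2}}\,z^{L}\;{}_1\tilde F_2\left(\tfrac L2+\tfrac12;L+\tfrac32,\tfrac L2+1;\tfrac z4\right)^{2},\end{aligned}$$ where both series over $L$ converge absolutely, and their terms with odd $L$ vanish. -/

import Mathlib

/-- The generalized hypergeometric function `pFq(a; b; z) = ∑ₙ (∏ (aᵢ)ₙ / ∏ (bⱼ)ₙ) zⁿ / n!`,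
with `(x)ₙ = x (x + 1) ⋯ (x + n - 1)` the rising factorial, `a` the multiset of the `p` upper
parameters and `b` the multiset of the `q` lower parameters (none of which should be a
non-positive integer). The regularized function is Mathlib's `Complex.regularizedHGFun a b z`. -/
noncomputable def genHypergeometric (a b : Multiset ℂ) (z : ℂ) : ℂ :=
  ∑' n : ℕ, (a.map fun x => (ascPochhammer ℂ n).eval x).prod /
    (b.map fun x => (ascPochhammer ℂ n).eval x).prod * (z ^ n / (n.factorial : ℂ))

/-!
With `I₀` the modified Bessel function, squaring the power series of `I₀(√z x)` and using
`∑ᵢ C(n, i) ^ 2 = C(2 n, n)` gives `₂F₃(1/2, 1/2; 1, 1, 3/2; z) = ∫₀¹ I₀(√z x) ^ 2 dx`. As `I₀`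
is even, Parseval's identity on `[0, 1]` for the even Legendre polynomials `P_{2 l}`, of squared
norm `1 / (4 l + 1)`, turns the integral into
`∑ₗ (4 l + 1) (∫₀¹ I₀(√z x) P_{2 l}(x) dx) ^ 2`. Each Legendre coefficient is a multiple of a `₁F₂`,
and Legendre's duplication formula rewrites the multiple in the stated form, with `L = 2 l`.

No integration is needed: the moments `∫₀¹ x ^ (2 s) P_{2 l}(x) dx` have a closed form, from which
Parseval's identity for two monomials follows by telescoping, and extends to power series by
absolute convergence.
-/

open scoped Nat
open Finset.HasAntidiagonal (antidiagonal)

section HasSum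

lemma hasSum_of_hasSum_even {M : Type*} [AddCommMonoid M] [TopologicalSpace M] {f : ℕ → M} {a : M}
    (hodd : ∀ n, f (2 * n + 1) = 0) (heven : HasSum (fun n => f (2 * n)) a) : HasSum f a := by
  refine ((mul_right_injective₀ two_ne_zero).hasSum_iff fun n hn => ?_).mp heven
  obtain ⟨k, rfl | rfl⟩ := n.even_or_odd'
  · exact absurd ⟨k, rfl⟩ hn
  · exact hodd k

lemma hasSum_sum_antidiagonal_of_hasSum {A M : Type*} [AddMonoid A] [Finset.HasAntidiagonal A]
    [AddCommMonoid M] [TopologicalSpace M] [ContinuousAdd M] [RegularSpace M]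
    {f : A × A → M} {a : M} (hf : HasSum f a) :
    HasSum (fun n => ∑ q ∈ antidiagonal n, f q) a := by
  have h := (Finset.HasAntidiagonal.sigmaAntidiagonalEquivProd (A := A)).hasSum_iff.mpr hf
  exact (h.sigma fun n => hasSum_fintype _).congr_fun fun n =>
    (Finset.sum_finset_coe f (antidiagonal n)).symm

end HasSum

section Pochhammer

lemma ascPochhammer_eval_mul_eval_add {R : Type*} [CommSemiring R] (x : R) (n m : ℕ) :
    (ascPochhammer R n).eval x * (ascPochhammer R m).eval (x + n) =
      (ascPochhammer R (n + m)).eval x := by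
  simp [← ascPochhammer_mul]

lemma ascPochhammer_eval_ne_zero {R : Type*} [CommRing R] [IsDomain R] {x : R}
    (hx : ∀ k : ℕ, x ≠ -k) (n : ℕ) : (ascPochhammer R n).eval x ≠ 0 := by
  rw [Ne, ascPochhammer_eval_eq_zero_iff]
  rintro ⟨k, -, hk⟩
  exact hx k (by rw [hk, neg_neg])

lemma factorial_mul_ascPochhammer_eval_add_one {R : Type*} [CommSemiring R] (l n : ℕ) :
    (l ! : R) * (ascPochhammer R n).eval (l + 1 : R) = (l + n)! := by
  rw [← Nat.cast_succ, ascPochhammer_nat_eq_natCast_ascFactorial, ← Nat.cast_mul,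
    Nat.factorial_mul_ascFactorial]

lemma four_pow_mul_ascPochhammer_eval_half {K : Type*} [Field K] [NeZero (2 : K)] (n : ℕ) :
    4 ^ n * (ascPochhammer K n).eval (1 / 2) = n.centralBinom * n ! := by
  have two_ne : (2 : K) ≠ 0 := two_ne_zero
  induction n with
  | zero => simp
  | succ n ih =>
    have h : ((n : K) + 1) * (n + 1).centralBinom = 2 * (2 * n + 1) * n.centralBinom := by
      exact_mod_cast congr_arg (Nat.cast (R := K)) n.succ_mul_centralBinom_succ
    calc 4 ^ (n + 1) * (ascPochhammer K (n + 1)).eval (1 / 2)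
        = 2 * (2 * n + 1) * (4 ^ n * (ascPochhammer K n).eval (1 / 2)) := by
          rw [ascPochhammer_succ_eval]; field_simp; ring
      _ = (n + 1) * (n + 1).centralBinom * n ! := by rw [ih, h]; ring
      _ = (n + 1).centralBinom * (n + 1)! := by push_cast [Nat.factorial_succ]; ring

lemma ne_neg_natCast_of_re_pos {x : ℂ} (hx : 0 < x.re) (k : ℕ) : x ≠ -k := by
  rintro rfl
  simp only [Complex.neg_re, Complex.natCast_re] at hx
  linarith [k.cast_nonneg (α := ℝ)]

end Pochhammer

section LegendreMoment

/-- The value `s (s - 1) ⋯ (s - l + 1) / (2 (s + 1/2) (s + 3/2) ⋯ (s + l + 1/2))` of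
`∫₀¹ x ^ (2 s) P_{2 l}(x) dx`, where `P_{2 l}` is the Legendre polynomial. -/
noncomputable def legendreMoment {K : Type*} [Field K] (s : K) (l : ℕ) : K :=
  (descPochhammer K l).eval s / (2 * (ascPochhammer K (l + 1)).eval (s + 1 / 2))

lemma map_legendreMoment {K L : Type*} [Field K] [Field L] (f : K →+* L) (s : K) (l : ℕ) :
    f (legendreMoment s l) = legendreMoment (f s) l := by
  simp only [legendreMoment, map_div₀, map_mul, map_ofNat, ← Polynomial.eval_map_apply,
    ascPochhammer_map, descPochhammer_map, map_add, map_one]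

variable {K : Type*} [Field K]

lemma legendreMoment_zero_mul [NeZero (2 : K)] {s : K} (h : s + 1 / 2 ≠ 0) :
    legendreMoment s 0 * (2 * (s + 1 / 2)) = 1 := by
  simp only [legendreMoment, descPochhammer_zero, zero_add, ascPochhammer_one, Polynomial.eval_one,
    Polynomial.eval_X]
  exact one_div_mul_cancel (mul_ne_zero two_ne_zero h)

lemma legendreMoment_succ_mul {s : K} {l : ℕ} (h : s + 1 / 2 + (l + 1 : ℕ) ≠ 0) :
    legendreMoment s (l + 1) * (s + 1 / 2 + (l + 1 : ℕ)) = legendreMoment s l * (s - l) := by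
  rw [legendreMoment, legendreMoment, descPochhammer_succ_eval, ascPochhammer_succ_eval (l + 1),
    ← mul_assoc, mul_div_mul_comm, mul_assoc, div_mul_cancel₀ _ h]

lemma legendreMoment_natCast_eq_zero {m l : ℕ} (h : m < l) : legendreMoment (m : K) l = 0 := by
  rw [legendreMoment, descPochhammer_eval_coe_nat_of_lt h, zero_div]

/-- As `1 / (2 s + 2 t + 1) = ∫₀¹ x ^ (2 s) x ^ (2 t) dx`, this is Parseval's identity for two even
monomials, with its exact remainder after `n` terms. -/
lemma sum_range_legendreMoment_mul [NeZero (2 : K)] {s t : K}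
    (hs : ∀ k : ℕ, s + 1 / 2 + k ≠ 0) (ht : ∀ k : ℕ, t + 1 / 2 + k ≠ 0) (n : ℕ) :
    (2 * s + 2 * t + 1) *
        ∑ l ∈ Finset.range n, (4 * l + 1) * (legendreMoment s l * legendreMoment t l) =
      1 - 4 * (s + 1 / 2 + n) * (t + 1 / 2 + n) * (legendreMoment s n * legendreMoment t n) := by
  have two_mul_half : (2 : K) * (1 / 2) = 1 := mul_one_div_cancel two_ne_zero
  induction n with
  | zero =>
    have hs0 := legendreMoment_zero_mul (s := s) (by simpa using hs 0)
    have ht0 := legendreMoment_zero_mul (s := t) (by simpa using ht 0)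
    rw [Finset.sum_range_zero, Nat.cast_zero]
    linear_combination legendreMoment t 0 * (2 * (t + 1 / 2)) * hs0 + ht0
  | succ n ih =>
    have hs1 := legendreMoment_succ_mul (hs (n + 1))
    have ht1 := legendreMoment_succ_mul (ht (n + 1))
    rw [Finset.sum_range_succ, mul_add, ih]
    linear_combination
      4 * legendreMoment t (n + 1) * (t + 1 / 2 + (n + 1 : ℕ)) * hs1 +
        4 * legendreMoment s n * (s - n) * ht1 -
        legendreMoment s n * legendreMoment t n *
          (2 * s + 2 * t + 4 * n + 2 * (1 / 2) + 1) * two_mul_half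

lemma legendreMoment_natCast_nonneg (m l : ℕ) : 0 ≤ legendreMoment (m : ℝ) l := by
  rw [legendreMoment, descPochhammer_eval_eq_descFactorial]
  have := ascPochhammer_pos (l + 1) ((m : ℝ) + 1 / 2) (by positivity)
  positivity

lemma hasSum_legendreMoment_natCast_mul (m n : ℕ) :
    HasSum (fun l : ℕ => (4 * l + 1) * (legendreMoment (m : ℝ) l * legendreMoment (n : ℝ) l))
      (2 * ((m + n : ℕ) : ℝ) + 1)⁻¹ := by
  have h := sum_range_legendreMoment_mul (s := (m : ℝ)) (t := (n : ℝ))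
    (fun k => by positivity) (fun k => by positivity) (m + 1)
  rw [legendreMoment_natCast_eq_zero m.lt_succ_self, zero_mul, mul_zero, sub_zero, ← mul_add,
    ← Nat.cast_add] at h
  rw [← eq_inv_of_mul_eq_one_right h]
  refine hasSum_sum_of_ne_finset_zero fun l hl => ?_
  rw [legendreMoment_natCast_eq_zero (by simpa using hl), zero_mul, mul_zero]

lemma legendreMoment_natCast_le_one (m l : ℕ) : legendreMoment (m : ℝ) l ≤ 1 := by
  have hnonneg (k : ℕ) := legendreMoment_natCast_nonneg m k
  refine (sq_le_one_iff₀ (hnonneg l)).mp ?_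
  calc legendreMoment (m : ℝ) l ^ 2
      ≤ (4 * l + 1) * (legendreMoment (m : ℝ) l * legendreMoment (m : ℝ) l) := by
        rw [sq]
        refine le_mul_of_one_le_left (mul_self_nonneg _) (le_add_of_nonneg_left (by positivity))
    _ ≤ (2 * ((m + m : ℕ) : ℝ) + 1)⁻¹ :=
        le_hasSum (hasSum_legendreMoment_natCast_mul m m) l fun k _ =>
          mul_nonneg (by positivity) (mul_self_nonneg _)
    _ ≤ 1 := inv_le_one_of_one_le₀ (le_add_of_nonneg_left (by positivity))

end LegendreMoment

section Parseval

lemma summable_norm_legendreMoment_smul {E : Type*} [SeminormedAddCommGroup E] [NormedSpace ℝ E]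
    {v : ℕ → E} (hv : Summable fun m => ‖v m‖) (l : ℕ) :
    Summable fun m : ℕ => ‖legendreMoment (m : ℝ) l • v m‖ := by
  refine hv.of_nonneg_of_le (fun _ => norm_nonneg _) fun m => ?_
  rw [norm_smul, Real.norm_of_nonneg (legendreMoment_natCast_nonneg m l)]
  exact mul_le_of_le_one_left (norm_nonneg _) (legendreMoment_natCast_le_one m l)

variable {R : Type*} [NormedRing R] [NormedAlgebra ℝ R] [CompleteSpace R] {v w : ℕ → R}

lemma summable_legendreMoment_mul_smul_mul
    (hv : Summable fun m => ‖v m‖) (hw : Summable fun m => ‖w m‖) :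
    Summable fun p : (ℕ × ℕ) × ℕ =>
      ((4 * p.2 + 1) * (legendreMoment (p.1.1 : ℝ) p.2 * legendreMoment (p.1.2 : ℝ) p.2)) •
        (v p.1.1 * w p.1.2) := by
  have hnonneg (m n l : ℕ) :
      0 ≤ (4 * l + 1) * (legendreMoment (m : ℝ) l * legendreMoment (n : ℝ) l) :=
    mul_nonneg (by positivity)
      (mul_nonneg (legendreMoment_natCast_nonneg m l) (legendreMoment_natCast_nonneg n l))
  have hfiber (q : ℕ × ℕ) : HasSum (fun l : ℕ =>
      ‖((4 * l + 1) * (legendreMoment (q.1 : ℝ) l * legendreMoment (q.2 : ℝ) l)) •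
        (v q.1 * w q.2)‖) ((2 * ((q.1 + q.2 : ℕ) : ℝ) + 1)⁻¹ * ‖v q.1 * w q.2‖) := by
    simp_rw [norm_smul, Real.norm_of_nonneg (hnonneg _ _ _)]
    exact (hasSum_legendreMoment_natCast_mul q.1 q.2).mul_right _
  refine Summable.of_norm ((summable_prod_of_nonneg fun _ => norm_nonneg _).mpr
    ⟨fun q => (hfiber q).summable, ?_⟩)
  refine (hv.mul_norm hw).of_nonneg_of_le
    (fun q => tsum_nonneg fun _ => norm_nonneg _) fun q => ?_
  rw [(hfiber q).tsum_eq]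
  exact mul_le_of_le_one_left (norm_nonneg _)
    (inv_le_one_of_one_le₀ (le_add_of_nonneg_left (by positivity)))

theorem hasSum_tsum_legendreMoment_smul_mul_tsum
    (hv : Summable fun m => ‖v m‖) (hw : Summable fun m => ‖w m‖) :
    HasSum
      (fun l : ℕ => (4 * l + 1 : ℝ) •
        ((∑' m : ℕ, legendreMoment (m : ℝ) l • v m) * ∑' n : ℕ, legendreMoment (n : ℝ) l • w n))
      (∑' k : ℕ, (2 * k + 1 : ℝ)⁻¹ • ∑ q ∈ antidiagonal k, v q.1 * w q.2) := by
  obtain ⟨S, hS⟩ := summable_legendreMoment_mul_smul_mul hv hw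
  have sum_degrees : HasSum (fun k : ℕ => (2 * k + 1 : ℝ)⁻¹ • ∑ q ∈ antidiagonal k, v q.1 * w q.2)
      S := by
    have sum_pairs : HasSum
        (fun q : ℕ × ℕ => (2 * ((q.1 + q.2 : ℕ) : ℝ) + 1)⁻¹ • (v q.1 * w q.2)) S :=
      hS.prod_fiberwise fun q => (hasSum_legendreMoment_natCast_mul q.1 q.2).smul_const _
    refine (hasSum_sum_antidiagonal_of_hasSum sum_pairs).congr_fun fun k => ?_
    rw [Finset.smul_sum]
    refine Finset.sum_congr rfl fun q hq => ?_
    rw [Finset.HasAntidiagonal.mem_antidiagonal.mp hq]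
  rw [sum_degrees.tsum_eq]
  refine ((Equiv.prodComm ℕ (ℕ × ℕ)).hasSum_iff.mpr hS).prod_fiberwise fun l => ?_
  have hv' := summable_norm_legendreMoment_smul hv l
  have hw' := summable_norm_legendreMoment_smul hw l
  rw [tsum_mul_tsum_of_summable_norm hv' hw']
  refine ((summable_mul_of_summable_norm hv' hw').hasSum.const_smul _).congr_fun fun q => ?_
  simp only [Function.comp_apply, Equiv.prodComm_apply, Prod.swap_prod_mk, smul_mul_smul_comm,
    mul_smul]

end Parseval

section HypergeometricSeries

/-- The coefficient of `x ^ (2 m)` in the power series of `I₀(√z x)`, where `I₀` is the modified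
Bessel function. -/
noncomputable def besselCoeff (z : ℂ) (m : ℕ) : ℂ := (z / 4) ^ m / (m ! : ℂ) ^ 2

lemma summable_norm_besselCoeff (z : ℂ) : Summable fun m => ‖besselCoeff z m‖ := by
  refine (Real.summable_pow_div_factorial ‖z / 4‖).of_nonneg_of_le (fun _ => norm_nonneg _)
    fun m => ?_
  rw [besselCoeff, norm_div, norm_pow, norm_pow, Complex.norm_natCast]
  have h : (1 : ℝ) ≤ m ! := by exact_mod_cast m.factorial_pos
  gcongr
  exact le_self_pow₀ h two_ne_zero

lemma besselCoeff_mul_besselCoeff (z : ℂ) (i j : ℕ) :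
    besselCoeff z i * besselCoeff z j =
      (z / 4) ^ (i + j) / ((i + j)! : ℂ) ^ 2 * ((i + j).choose i : ℂ) ^ 2 := by
  have hi : (i ! : ℂ) ≠ 0 := by exact_mod_cast i.factorial_ne_zero
  have hj : (j ! : ℂ) ≠ 0 := by exact_mod_cast j.factorial_ne_zero
  have hij : ((i + j)! : ℂ) ≠ 0 := by exact_mod_cast (i + j).factorial_ne_zero
  have hchoose : ((i + j).choose i : ℂ) = (i + j)! / (i ! * j !) := Nat.cast_add_choose ℂ
  rw [besselCoeff, besselCoeff, hchoose, pow_add]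
  field_simp

lemma sum_antidiagonal_besselCoeff_mul (z : ℂ) (n : ℕ) :
    ∑ q ∈ antidiagonal n, besselCoeff z q.1 * besselCoeff z q.2 =
      (z / 4) ^ n / (n ! : ℂ) ^ 2 * n.centralBinom := by
  have hchoose : (n.centralBinom : ℂ) = ∑ q ∈ antidiagonal n, (n.choose q.1 : ℂ) ^ 2 := by
    rw [Finset.Nat.sum_antidiagonal_eq_sum_range_succ_mk, Nat.centralBinom,
      ← Nat.sum_range_choose_sq]
    exact_mod_cast rfl
  rw [hchoose, Finset.mul_sum]
  refine Finset.sum_congr rfl fun q hq => ?_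
  rw [besselCoeff_mul_besselCoeff, Finset.HasAntidiagonal.mem_antidiagonal.mp hq]

lemma tsum_sum_antidiagonal_besselCoeff_mul (z : ℂ) :
    ∑' n : ℕ, (2 * n + 1 : ℝ)⁻¹ • ∑ q ∈ antidiagonal n, besselCoeff z q.1 * besselCoeff z q.2 =
      genHypergeometric {1 / 2, 1 / 2} {1, 1, 3 / 2} z := by
  refine tsum_congr fun n => ?_
  have half_ne : (ascPochhammer ℂ n).eval (1 / 2) ≠ 0 :=
    ascPochhammer_eval_ne_zero (ne_neg_natCast_of_re_pos (by norm_num)) n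
  have three_halves : (ascPochhammer ℂ n).eval (3 / 2) =
      (ascPochhammer ℂ n).eval (1 / 2) * (2 * n + 1) := by
    have h := ascPochhammer_eval_mul_eval_add (1 / 2 : ℂ) 1 n
    rw [add_comm 1 n, ascPochhammer_succ_eval n, ascPochhammer_one, Polynomial.eval_X,
      show (1 / 2 : ℂ) + (1 : ℕ) = 3 / 2 by norm_num] at h
    linear_combination 2 * h
  have hn : (n ! : ℂ) ≠ 0 := by exact_mod_cast n.factorial_ne_zero
  have hodd : (2 * n + 1 : ℂ) ≠ 0 := by exact_mod_cast (2 * n).succ_ne_zero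
  have hbinom : (n.centralBinom : ℂ) = 4 ^ n * (ascPochhammer ℂ n).eval (1 / 2) / n ! := by
    rw [four_pow_mul_ascPochhammer_eval_half, mul_div_cancel_right₀ _ hn]
  rw [sum_antidiagonal_besselCoeff_mul, hbinom, Complex.real_smul, div_pow]
  simp only [Multiset.insert_eq_cons, Multiset.map_cons, Multiset.map_singleton,
    Multiset.prod_cons, Multiset.prod_singleton, ascPochhammer_eval_one, three_halves]
  push_cast
  field_simp

lemma besselCoeff_add (z : ℂ) (n l : ℕ) :
    besselCoeff z (n + l) =
      besselCoeff z l * ((z / 4) ^ n / ((ascPochhammer ℂ n).eval (l + 1 : ℂ)) ^ 2) := by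
  rw [besselCoeff, besselCoeff, add_comm n l, ← factorial_mul_ascPochhammer_eval_add_one,
    pow_add, mul_pow, mul_div_mul_comm]

lemma legendreMoment_natCast_add (n l : ℕ) :
    legendreMoment ((n + l : ℕ) : ℂ) l =
      legendreMoment (l : ℂ) l *
        ((ascPochhammer ℂ n).eval (l + 1 : ℂ) * (ascPochhammer ℂ n).eval (l + 1 / 2 : ℂ) /
          (n ! * (ascPochhammer ℂ n).eval (2 * l + 3 / 2 : ℂ))) := by
  have half_pos : 0 < (l + 1 / 2 : ℂ).re := by norm_num; positivity
  have h := ascPochhammer_eval_ne_zero (ne_neg_natCast_of_re_pos half_pos) n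
  have hn : (n ! : ℂ) ≠ 0 := by exact_mod_cast n.factorial_ne_zero
  have numerator : ((n + l).descFactorial l : ℂ) =
      l.descFactorial l * (ascPochhammer ℂ n).eval (l + 1 : ℂ) / n ! := by
    rw [eq_div_iff hn, Nat.descFactorial_self, factorial_mul_ascPochhammer_eval_add_one,
      mul_comm, add_comm l n]
    have := Nat.factorial_mul_descFactorial (Nat.le_add_left l n)
    rw [Nat.add_sub_cancel] at this
    exact_mod_cast this
  have denominator : (ascPochhammer ℂ (l + 1)).eval ((n + l : ℕ) + 1 / 2 : ℂ) =
      (ascPochhammer ℂ (l + 1)).eval (l + 1 / 2 : ℂ) *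
        (ascPochhammer ℂ n).eval (2 * l + 3 / 2 : ℂ) /
          (ascPochhammer ℂ n).eval (l + 1 / 2 : ℂ) := by
    rw [eq_div_iff h, mul_comm,
      show ((n + l : ℕ) + 1 / 2 : ℂ) = l + 1 / 2 + n by push_cast; ring,
      show (2 * l + 3 / 2 : ℂ) = l + 1 / 2 + (l + 1 : ℕ) by push_cast; ring,
      ascPochhammer_eval_mul_eval_add, ascPochhammer_eval_mul_eval_add, add_comm n]
  rw [legendreMoment, legendreMoment, descPochhammer_eval_eq_descFactorial,
    descPochhammer_eval_eq_descFactorial, numerator, denominator]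
  field_simp

lemma tsum_legendreMoment_smul_besselCoeff (z : ℂ) (l : ℕ) :
    ∑' m : ℕ, legendreMoment (m : ℝ) l • besselCoeff z m =
      legendreMoment (l : ℂ) l * besselCoeff z l *
        genHypergeometric {(l + 1 / 2 : ℂ)} {(l + 1 : ℂ), (2 * l + 3 / 2 : ℂ)} (z / 4) := by
  have smul_eq_mul (m : ℕ) : legendreMoment (m : ℝ) l • besselCoeff z m =
      legendreMoment (m : ℂ) l * besselCoeff z m := by
    rw [Complex.real_smul, ← Complex.ofReal_natCast]
    congr 1
    exact map_legendreMoment Complex.ofRealHom m l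
  have support_subset : Function.support (fun m : ℕ => legendreMoment (m : ℂ) l * besselCoeff z m) ⊆
      Set.range (· + l) := fun m hm => by
    obtain hlm | hlm := le_or_gt l m
    · exact ⟨m - l, Nat.sub_add_cancel hlm⟩
    · exact absurd (mul_eq_zero_of_left (legendreMoment_natCast_eq_zero hlm) _) hm
  simp_rw [smul_eq_mul]
  rw [← (add_left_injective l).tsum_eq support_subset, genHypergeometric, ← tsum_mul_left]
  refine tsum_congr fun n => ?_
  have hl : (ascPochhammer ℂ n).eval (l + 1 : ℂ) ≠ 0 :=
    ascPochhammer_eval_ne_zero (ne_neg_natCast_of_re_pos (by norm_num; positivity)) n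
  rw [legendreMoment_natCast_add, besselCoeff_add]
  simp only [Multiset.insert_eq_cons, Multiset.map_cons, Multiset.map_singleton,
    Multiset.prod_cons, Multiset.prod_singleton]
  field_simp

theorem hasSum_sq_legendreMoment_mul_genHypergeometric (z : ℂ) :
    HasSum
      (fun l : ℕ => (4 * l + 1) * (legendreMoment (l : ℂ) l * besselCoeff z l *
        genHypergeometric {(l + 1 / 2 : ℂ)} {(l + 1 : ℂ), (2 * l + 3 / 2 : ℂ)} (z / 4)) ^ 2)
      (genHypergeometric {1 / 2, 1 / 2} {1, 1, 3 / 2} z) := by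
  have hz := summable_norm_besselCoeff z
  rw [← tsum_sum_antidiagonal_besselCoeff_mul]
  refine (hasSum_tsum_legendreMoment_smul_mul_tsum hz hz).congr_fun fun l => ?_
  rw [tsum_legendreMoment_smul_besselCoeff, ← sq, Complex.real_smul]
  push_cast
  rfl

end HypergeometricSeries

section Gamma

theorem regularizedHGFun_eq_genHypergeometric_div (a : Multiset ℂ) {b : Multiset ℂ}
    (hb : ∀ x ∈ b, ∀ k : ℕ, x ≠ -k) (z : ℂ) :
    Complex.regularizedHGFun a b z = genHypergeometric a b z / (b.map Complex.Gamma).prod := by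
  have tsum_coeff : Complex.regularizedHGFun a b z =
      ∑' n : ℕ, Complex.regularizedHGFunCoeff a b n * z ^ n :=
    FormalMultilinearSeries.ofScalars_sum_eq _ z
  have prod_Gamma_add (n : ℕ) : (b.map (Complex.Gamma <| · + (n : ℂ))).prod =
      (b.map Complex.Gamma).prod * (b.map fun x => (ascPochhammer ℂ n).eval x).prod := by
    rw [← Multiset.prod_map_mul]
    refine congr_arg _ (Multiset.map_congr rfl fun x hx => ?_)
    rw [← Complex.Gamma_add_nat_div_Gamma_eq x (hb x hx),
      mul_div_cancel₀ _ (Complex.Gamma_ne_zero (hb x hx))]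
  rw [tsum_coeff, genHypergeometric, ← tsum_div_const]
  refine tsum_congr fun n => ?_
  rw [Complex.regularizedHGFunCoeff, prod_Gamma_add]
  simp only [div_eq_mul_inv, mul_inv]
  ring

lemma regularizedHGFun_pair_eq_genHypergeometric_div (a : Multiset ℂ) {b c : ℂ}
    (hb : ∀ k : ℕ, b ≠ -k) (hc : ∀ k : ℕ, c ≠ -k) (z : ℂ) :
    Complex.regularizedHGFun a {b, c} z =
      genHypergeometric a {b, c} z / (Complex.Gamma b * Complex.Gamma c) := by
  rw [regularizedHGFun_eq_genHypergeometric_div _ (by simpa using ⟨hb, hc⟩),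
    Multiset.insert_eq_cons, Multiset.map_cons, Multiset.map_singleton, Multiset.prod_cons,
    Multiset.prod_singleton]

lemma factorial_mul_Gamma_mul_Gamma (l : ℕ) :
    l ! * Complex.Gamma (l + 1 / 2) * Complex.Gamma (2 * l + 3 / 2) =
      Real.pi * Complex.Gamma (4 * l + 2) / 2 ^ (6 * l + 1) := by
  have sq_sqrt_pi : ((√Real.pi : ℝ) : ℂ) * (√Real.pi : ℝ) = Real.pi := by
    exact_mod_cast Real.mul_self_sqrt Real.pi_pos.le
  have duplication_half : Complex.Gamma (l + 1 / 2) * l ! =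
      Complex.Gamma (2 * l + 1) * (2 ^ (2 * l))⁻¹ * (√Real.pi : ℝ) := by
    have h := Complex.Gamma_mul_Gamma_add_half (l + 1 / 2)
    rwa [show (l + 1 / 2 : ℂ) + 1 / 2 = l + 1 by ring, Complex.Gamma_nat_eq_factorial,
      show 2 * (l + 1 / 2 : ℂ) = 2 * l + 1 by ring,
      show (1 - (2 * l + 1) : ℂ) = -(2 * l : ℕ) by push_cast; ring, Complex.cpow_neg,
      Complex.cpow_natCast] at h
  have duplication_one : Complex.Gamma (2 * l + 1) * Complex.Gamma (2 * l + 3 / 2) =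
      Complex.Gamma (4 * l + 2) * (2 ^ (4 * l + 1))⁻¹ * (√Real.pi : ℝ) := by
    have h := Complex.Gamma_mul_Gamma_add_half (2 * l + 1)
    rwa [show (2 * l + 1 : ℂ) + 1 / 2 = 2 * l + 3 / 2 by ring,
      show 2 * (2 * l + 1 : ℂ) = 4 * l + 2 by ring,
      show (1 - (4 * l + 2) : ℂ) = -(4 * l + 1 : ℕ) by push_cast; ring, Complex.cpow_neg,
      Complex.cpow_natCast] at h
  calc l ! * Complex.Gamma (l + 1 / 2) * Complex.Gamma (2 * l + 3 / 2)
      = (2 ^ (2 * l))⁻¹ * (√Real.pi : ℝ) *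
          (Complex.Gamma (2 * l + 1) * Complex.Gamma (2 * l + 3 / 2)) := by
        linear_combination Complex.Gamma (2 * l + 3 / 2) * duplication_half
    _ = (√Real.pi : ℝ) * (√Real.pi : ℝ) * Complex.Gamma (4 * l + 2) /
          2 ^ (2 * l + (4 * l + 1)) := by
        rw [duplication_one, pow_add, div_eq_mul_inv, mul_inv]; ring
    _ = Real.pi * Complex.Gamma (4 * l + 2) / 2 ^ (6 * l + 1) := by
        rw [sq_sqrt_pi]; ring_nf

lemma legendreMoment_natCast_self (l : ℕ) :
    legendreMoment (l : ℂ) l =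
      Real.pi * Complex.Gamma (4 * l + 2) /
        (2 ^ (6 * l + 2) * Complex.Gamma (2 * l + 3 / 2) ^ 2) := by
  have half_pos : 0 < (l + 1 / 2 : ℂ).re := by norm_num; positivity
  have hG : Complex.Gamma (2 * l + 3 / 2) ≠ 0 :=
    Complex.Gamma_ne_zero_of_re_pos (by norm_num; positivity)
  calc legendreMoment (l : ℂ) l
      = l ! / (2 * (Complex.Gamma (2 * l + 3 / 2) / Complex.Gamma (l + 1 / 2))) := by
        rw [legendreMoment, descPochhammer_eval_eq_descFactorial, Nat.descFactorial_self,
          ← Complex.Gamma_add_nat_div_Gamma_eq _ (ne_neg_natCast_of_re_pos half_pos),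
          show (l + 1 / 2 + (l + 1 : ℕ) : ℂ) = 2 * l + 3 / 2 by push_cast; ring]
    _ = l ! * Complex.Gamma (l + 1 / 2) * Complex.Gamma (2 * l + 3 / 2) /
          (2 * Complex.Gamma (2 * l + 3 / 2) ^ 2) := by
        generalize Complex.Gamma (2 * l + 3 / 2) = G at hG ⊢
        generalize Complex.Gamma (l + 1 / 2) = H
        field_simp
    _ = _ := by
        rw [factorial_mul_Gamma_mul_Gamma, div_div]
        ring

end Gamma

lemma legendreMoment_mul_besselCoeff_natCast_self (z : ℂ) (l : ℕ) :
    legendreMoment (l : ℂ) l * besselCoeff z l =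
      Real.pi / 2 ^ (8 * l + 2) * Complex.Gamma (4 * l + 2) /
        ((l ! : ℂ) ^ 2 * Complex.Gamma (2 * l + 3 / 2) ^ 2) * z ^ l := by
  have h : (2 : ℂ) ^ (8 * l + 2) = 2 ^ (6 * l + 2) * 4 ^ l := by
    rw [show (4 : ℂ) = 2 ^ 2 by norm_num, ← pow_mul, ← pow_add]
    congr 1
    ring
  rw [legendreMoment_natCast_self, besselCoeff, h, div_pow]
  simp only [div_eq_mul_inv, mul_inv]
  ring

lemma prefactor_two_mul (l : ℕ) :
    (Real.pi : ℂ) ^ 2 * Complex.I ^ (4 * (2 * l)) *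
        (2 : ℂ) ^ (-8 * ((2 * l : ℕ) : ℤ) - 6) * ((-1 : ℂ) ^ (2 * l) + 1) ^ 2 =
      (Real.pi / 2 ^ (8 * l + 2)) ^ 2 := by
  have two_zpow : (2 : ℂ) ^ (-8 * ((2 * l : ℕ) : ℤ) - 6) = ((2 ^ (8 * l + 2)) ^ 2 * 4)⁻¹ := by
    rw [show ((2 ^ (8 * l + 2)) ^ 2 * 4 : ℂ) = 2 ^ (16 * l + 6) by ring, ← zpow_natCast,
      ← zpow_neg]
    congr 1
    push_cast
    ring
  rw [pow_mul Complex.I, Complex.I_pow_four, one_pow, two_zpow, pow_mul (-1 : ℂ), neg_one_sq,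
    one_pow]
  field_simp
  norm_num

theorem mainTheorem3 (z : ℂ) :
    HasSum
      (fun L : ℕ =>
        ((Real.pi : ℂ) ^ 2 * Complex.I ^ (4 * L) * (2 : ℂ) ^ (-8 * (L : ℤ) - 6) *
            ((-1 : ℂ) ^ L + 1) ^ 2 * (2 * (L : ℂ) + 1) * Complex.Gamma (2 * (L : ℂ) + 2) ^ 2 /
          (Complex.Gamma ((L : ℂ) / 2 + 1) ^ 4 * Complex.Gamma ((L : ℂ) + 3 / 2) ^ 2 *
            Complex.Gamma ((1 / 2 : ℂ) * (2 * (L : ℂ) + 3)) ^ 2)) *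
          z ^ L *
          genHypergeometric {(L : ℂ) / 2 + 1 / 2} {(L : ℂ) / 2 + 1, (L : ℂ) + 3 / 2} (z / 4) ^ 2)
      (genHypergeometric {1 / 2, 1 / 2} {1, 1, 3 / 2} z) ∧
    HasSum
      (fun L : ℕ =>
        ((Real.pi : ℂ) ^ 2 * Complex.I ^ (4 * L) * (2 : ℂ) ^ (-8 * (L : ℤ) - 6) *
            ((-1 : ℂ) ^ L + 1) ^ 2 * (2 * (L : ℂ) + 1) * Complex.Gamma (2 * (L : ℂ) + 2) ^ 2 /
          (Complex.Gamma ((L : ℂ) / 2 + 1) ^ 2 *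
            Complex.Gamma ((1 / 2 : ℂ) * (2 * (L : ℂ) + 3)) ^ 2)) *
          z ^ L *
          Complex.regularizedHGFun {(L : ℂ) / 2 + 1 / 2} {(L : ℂ) + 3 / 2, (L : ℂ) / 2 + 1} (z / 4) ^ 2)
      (genHypergeometric {1 / 2, 1 / 2} {1, 1, 3 / 2} z) := by
  refine (and_iff_left_of_imp fun first => first.congr_fun fun L => ?regularized).mpr
    (hasSum_of_hasSum_even (fun l => ?odd)
      ((hasSum_sq_legendreMoment_mul_genHypergeometric z).congr_fun fun l => ?even))
  case odd => simp [pow_succ, pow_mul]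
  case even =>
    rw [legendreMoment_mul_besselCoeff_natCast_self, prefactor_two_mul, Nat.cast_mul, Nat.cast_two,
      mul_div_cancel_left₀ _ two_ne_zero, Complex.Gamma_nat_eq_factorial,
      show 2 * (2 * l : ℂ) = 4 * l by ring, show (1 / 2 : ℂ) * (4 * l + 3) = 2 * l + 3 / 2 by ring]
    simp only [div_eq_mul_inv, mul_inv]
    ring
  case regularized =>
    have hb : 0 < ((L : ℂ) + 3 / 2).re := by norm_num; positivity
    have hc : 0 < ((L : ℂ) / 2 + 1).re := by norm_num; positivity
    rw [regularizedHGFun_pair_eq_genHypergeometric_div _ (ne_neg_natCast_of_re_pos hb)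
      (ne_neg_natCast_of_re_pos hc), Multiset.pair_comm]
    simp only [div_eq_mul_inv, mul_inv]
    ring
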